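/- Fix an integer $n\ge 2$ and a number $\alpha\in(0,1)$. A \emph{domain} over $\mathbb R^n$ is a pair $D=(D_{in},D_{out})$ of Borel probability measures on $\mathbb R^n$. Let $\mathcal D_c$ be the set of all domains over $\mathbb R^n$ such that $\operatorname{supp}(D_{in})\cap\operatorname{supp}(D_{out})=\emptyset$ (DSA) and $\operatorname{supp}(D_{in})$ is convex (ConvexID), where $\operatorname{supp}$ is the closed topological support. A \emph{hypothesis} is a subset $h\subseteq\mathbb R^n$ (points of $h$ are classified as in-distribution), and its \emph{risk} is $$R^\alpha_D(h)=(1-\alpha)\,D_{in}(\mathbb R^n\setminus h)+\alpha\,D_{out}(h).$$ A \emph{learning algorithm} is an arbitrary, possibly randomized, rule which receives $\epsilon,\delta$ and successively draws independent samples from $D_{in}$ through an oracle $EX(D_{in})$; after each number of samples (possibly none) it decides, from $\epsilon,\delta$, the samples seen so far and its internal randomness (independent of the samples), either to draw another sample or to stop and output a hypothesis. OOD detection is \emph{non-uniformly learnable} for a set $\mathcal D$ of domains in the hypothesis space $\mathcal H$, with OOD probability $\alpha$, if there is a learning algorithm $\mathcal A$ such that for all $\epsilon,\delta\in(0,1/2)$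 and all $D\in\mathcal D$, given $\epsilon$, $\delta$ and access to $EX(D_{in})$, the algorithm $\mathcal A$ terminates with probability $1$ and outputs some $h\in\mathcal H$, which with probability at least $1-\delta$ satisfies $R^\alpha_D(h)\le\inf_{h'\in\mathcal H}R^\alpha_D(h')+\epsilon$; the probability is over the samples and the internal randomness of $\mathcal A$. (No measurability of hypotheses or algorithms is required: where needed, $D_{in}(\mathbb R^n\setminus h)$, $D_{out}(h)$ and the probability of failure, required to be $0$ for termination and at most $\delta$ for the risk bound, are outer measures.) \textbf{Theorem.} For every integer $n\ge2$ and every $\alpha\in(0,1)$, OOD detection is \emph{not} non-uniformly learnable for $\mathcal D_c$ in the hypothesis space $\mathcal P(\mathbb R^n)$ of all subsets of $\mathbb R^n$. In particular, the combination of DSA and ConvexID does not always imply non-uniform learnability of OOD detection. -/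

import Mathlib

open MeasureTheory Set
open scoped ENNReal

universe u v

namespace OODDetection

/-- A domain over `X`: an in-distribution (ID) and an out-of-distribution (OOD) probability
distribution on `X`. -/
structure Domain (X : Type v) [MeasurableSpace X] where
  inDist : ProbabilityMeasure X
  outDist : ProbabilityMeasure X

/-- A hypothesis is a subset of `X`, identified with its indicator classifier `X → {0, 1}`. -/
abbrev Hypothesis (X : Type v) := Set X

section Risk

variable {X : Type v} [MeasurableSpace X]

/-- The law of a labelled test point `(x, y)`: with probability `1 - α`, `x` is drawn from the ID
distribution and `y = true`; with probability `α`, `x` is drawn from the OOD distribution and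
`y = false`. -/
noncomputable def testLaw (α : ℝ) (D : Domain X) : Measure (X × Bool) :=
  ENNReal.ofReal (1 - α) • (D.inDist : Measure X).map (fun x => (x, true)) +
    ENNReal.ofReal α • (D.outDist : Measure X).map (fun x => (x, false))

/-- The risk `R^α_D(h)`, i.e. the expected 0-1 loss of `h` on a labelled test point, which is the
probability that the label predicted by `h` differs from the true one. (For a non-measurable `h`
this is the outer probability.) -/
noncomputable def risk (α : ℝ) (D : Domain X) (h : Hypothesis X) : ℝ≥0∞ :=
  testLaw α D {p | ¬ (p.1 ∈ h ↔ p.2 = true)}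

/-- `R^α_D(h) = (1 - α) R^in_D(h) + α R^out_D(h)`. -/
theorem risk_eq (α : ℝ) (D : Domain X) (h : Hypothesis X) :
    risk α D h = ENNReal.ofReal (1 - α) * (D.inDist : Measure X) hᶜ +
      ENNReal.ofReal α * (D.outDist : Measure X) h := by
  have e : ∀ b : Bool, MeasurableEmbedding (fun x : X => (x, b)) := fun b =>
    measurableEmbedding_prod_mk_right b
  simp only [risk, testLaw, Measure.add_apply, Measure.smul_apply, smul_eq_mul]
  rw [(e true).map_apply, (e false).map_apply]
  congr 3
  · ext x; simp
  · ext x; simp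

end Risk

/-- A (possibly randomized) learning algorithm with access to an example oracle. It first draws its
internal randomness, a seed `s` of law `seedLaw`. Having received from the oracle exactly the
samples `x 0, …, x (k - 1)`, on input `ε`, `δ` it either halts with the hypothesis `h`
(`step ε δ s k x = some h`) or calls the oracle once more (`step ε δ s k x = none`). -/
structure LearningAlgorithm (X : Type v) where
  Seed : Type u
  [seedSpace : MeasurableSpace Seed]
  seedLaw : ProbabilityMeasure Seed
  step : (ε δ : ℝ) → Seed → (k : ℕ) → (Fin k → X) → Option (Hypothesis X)

attribute [instance] LearningAlgorithm.seedSpace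

namespace LearningAlgorithm

variable {X : Type v}

/-- Run with seed `s` on the stream `x` of oracle answers, the algorithm terminates (after finitely
many calls) and its output is `h`. -/
def Outputs (A : LearningAlgorithm.{u, v} X) (ε δ : ℝ) (s : A.Seed) (x : ℕ → X)
    (h : Hypothesis X) : Prop :=
  ∃ k : ℕ, A.step ε δ s k (fun i => x i) = some h ∧
    ∀ j < k, A.step ε δ s j (fun i => x i) = none

/-- The joint law of the internal randomness and of the independent answers of the oracle
`EX(D_in)`. -/
noncomputable def runLaw [MeasurableSpace X] (A : LearningAlgorithm.{u, v} X) (D : Domain X) :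
    Measure (A.Seed × (ℕ → X)) :=
  (A.seedLaw : Measure A.Seed).prod (Measure.infinitePi fun _ : ℕ => (D.inDist : Measure X))

end LearningAlgorithm

/-- OOD detection is non-uniformly learnable for the domain space `𝒟` in the hypothesis space `H`,
with OOD probability `α`: some algorithm, on all inputs `ε, δ ∈ (0, 1/2)` and for every domain in
`𝒟`, terminates with probability one with an output in `H`, and with probability at least `1 - δ`
its output has risk at most `inf_{h' ∈ H} R^α_D(h') + ε`. The last condition is written as: the
(outer) probability of the complementary event is at most `δ`. -/
def NonUniformlyLearnable {X : Type v} [MeasurableSpace X] (𝒟 : Set (Domain X))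
    (H : Set (Hypothesis X)) (α : ℝ) : Prop :=
  ∃ A : LearningAlgorithm.{u, v} X,
    ∀ ε ∈ Ioo (0 : ℝ) (1 / 2), ∀ δ ∈ Ioo (0 : ℝ) (1 / 2), ∀ D ∈ 𝒟,
      (∀ᵐ ω ∂A.runLaw D, ∃ h ∈ H, A.Outputs ε δ ω.1 ω.2 h) ∧
      A.runLaw D {ω | ¬ ∃ h ∈ H, A.Outputs ε δ ω.1 ω.2 h ∧
        risk α D h ≤ (⨅ h' ∈ H, risk α D h') + ENNReal.ofReal ε} ≤ ENNReal.ofReal δ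

/-- Disjoint Supports Assumption: the ID and OOD distributions have disjoint (closed topological)
supports. -/
def DSA {X : Type v} [TopologicalSpace X] [MeasurableSpace X] (D : Domain X) : Prop :=
  Disjoint (D.inDist : Measure X).support (D.outDist : Measure X).support

/-- Convex ID Support Assumption for a domain over `ℝⁿ`. -/
def ConvexID {n : ℕ} (D : Domain (EuclideanSpace ℝ (Fin n))) : Prop :=
  Convex ℝ (D.inDist : Measure (EuclideanSpace ℝ (Fin n))).support

/-- The domain space of all domains over `ℝⁿ` which satisfy both DSA and ConvexID. -/
def convexDomainSpace (n : ℕ) : Set (Domain (EuclideanSpace ℝ (Fin n))) :=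
  {D | DSA D ∧ ConvexID D}

end OODDetection

namespace OODDetection

/-! A strictly convex body has arbitrarily many disjoint caps, and removing one cap leaves a convex
set. Let `μ` have the epigraph of a parabola as support, with half of its mass uniform along an arc,
and let `D₀` have ID law `μ`. On `D₀` the algorithm stops within some `k` samples with outer
probability above 1/2. Cut `M` disjoint caps, `M` much larger than `k`, and let `D j` have ID law
`μ` conditioned off cap `j` and OOD law uniform on a piece of the arc inside that cap. The caps have
total mass at most 1, so `k` samples of `μ` rarely hit a given one, and the algorithm cannot tell
`D₀` from `D j` (`prod_infinitePi_le_cond`). Hence some run outputs an `h` good for `D₀` and for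
more than half of the `D j`. Then `h` misses little of `μ`, yet misses most of more than half of the
arc pieces, which together carry a fixed share of `μ`: a contradiction
(`not_nonUniformlyLearnable_of_caps`). The geometry is `exists_parabola_caps`. -/

open ProbabilityTheory

/-! ### Coupling i.i.d. samples of a law with samples of its conditioning -/

section Coupling

variable {X : Type*} [MeasurableSpace X]

/-- The first `k` terms of `x`, followed by the terms of `y` from index `k` on. -/
def splice (k : ℕ) (x y : ℕ → X) : ℕ → X := fun i => if i < k then x i else y i

theorem measurable_splice (k : ℕ) :
    Measurable fun p : (ℕ → X) × (ℕ → X) => splice k p.1 p.2 := by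
  refine measurable_pi_lambda _ fun i => ?_
  by_cases hi : i < k
  · simp only [splice, hi, if_true]; fun_prop
  · simp only [splice, hi, if_false]; fun_prop

/-- Conditioning the first `k` samples to lie in `O`, and continuing with samples from `μ[|O]`,
gives an i.i.d. sequence of law `μ[|O]`. -/
theorem map_splice_cond (μ : Measure X) [IsProbabilityMeasure μ] {O : Set X}
    (hO : MeasurableSet O) (h0 : μ O ≠ 0) (k : ℕ) :
    (((Measure.infinitePi fun _ : ℕ => μ)[|(Finset.range k : Set ℕ).pi fun _ => O]).prod
      (Measure.infinitePi fun _ : ℕ => μ[|O])).map (fun p => splice k p.1 p.2) =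
    Measure.infinitePi fun _ : ℕ => μ[|O] := by
  have := cond_isProbabilityMeasure h0
  refine Measure.eq_infinitePi _ fun s t ht => ?_
  rw [Measure.map_apply (measurable_splice k) (.pi s.countable_toSet fun _ _ => ht _)]
  have e : (fun p : (ℕ → X) × (ℕ → X) => splice k p.1 p.2) ⁻¹' (s : Set ℕ).pi t =
      ((s.filter (· < k) : Finset ℕ) : Set ℕ).pi t ×ˢ
        ((s.filter (¬ · < k) : Finset ℕ) : Set ℕ).pi t := by
    ext p
    simp only [splice, mem_preimage, Set.mem_pi, Finset.mem_coe, Finset.mem_filter, mem_prod]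
    constructor
    · exact fun h => ⟨fun i hi => by simpa [hi.2] using h i hi.1,
        fun i hi => by simpa [hi.2] using h i hi.1⟩
    · intro h i hi
      by_cases hk : i < k
      · simpa [hk] using h.1 i ⟨hi, hk⟩
      · simpa [hk] using h.2 i ⟨hi, hk⟩
  have hA : MeasurableSet ((Finset.range k : Set ℕ).pi fun _ : ℕ => O) :=
    .pi (Finset.range k).countable_toSet fun _ _ => hO
  have e2 : ((Finset.range k : Set ℕ).pi fun _ : ℕ => O) ∩
      ((s.filter (· < k) : Finset ℕ) : Set ℕ).pi t =
      (Finset.range k : Set ℕ).pi fun i => O ∩ (if i ∈ s then t i else univ) := by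
    ext x
    simp only [mem_inter_iff, Set.mem_pi, Finset.mem_coe, Finset.mem_filter, Finset.mem_range]
    constructor
    · intro h i hi
      refine ⟨h.1 i hi, ?_⟩
      split_ifs with hs
      · exact h.2 i ⟨hs, hi⟩
      · trivial
    · intro h
      refine ⟨fun i hi => (h i hi).1, fun i hi => ?_⟩
      simpa [hi.1] using (h i hi.2).2
  rw [e, Measure.prod_prod, cond_apply hA, e2, Measure.infinitePi_pi _ fun _ _ => hO,
    Measure.infinitePi_pi _ fun i _ => hO.inter (by split_ifs; exacts [ht i, .univ]),
    Measure.infinitePi_pi _ fun i _ => ht i, ← Finset.prod_filter_mul_prod_filter_not s (· < k)]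
  congr 1
  rw [ENNReal.prod_inv_distrib (by simp [h0, Set.Pairwise]), ← Finset.prod_mul_distrib]
  have e3 : ∀ i ∈ Finset.range k, (μ O)⁻¹ * μ (O ∩ (if i ∈ s then t i else univ)) =
      if i ∈ s then μ[t i | O] else 1 := by
    intro i _
    split_ifs
    · rw [cond_apply hO]
    · rw [inter_univ, ENNReal.inv_mul_cancel h0 (measure_ne_top _ _)]
  rw [Finset.prod_congr rfl e3, ← Finset.prod_filter]
  congr 1
  ext i
  simp [and_comm]

/-- An event which depends on the first `k` samples only has about the same outer probability
under `μ` as under `μ[|O]`. -/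
theorem prod_infinitePi_le_cond {Ω : Type*} [MeasurableSpace Ω] (σ : Measure Ω)
    [IsProbabilityMeasure σ] (μ : Measure X) [IsProbabilityMeasure μ] {O : Set X}
    (hO : MeasurableSet O) (h0 : μ O ≠ 0) (k : ℕ) {F : Set (Ω × (ℕ → X))}
    (hF : ∀ s x y, (∀ i < k, x i = y i) → (s, x) ∈ F → (s, y) ∈ F) :
    σ.prod (Measure.infinitePi fun _ => μ) F ≤
      σ.prod (Measure.infinitePi fun _ => μ[|O]) F + k * μ Oᶜ := by
  have := cond_isProbabilityMeasure h0
  set P := Measure.infinitePi fun _ : ℕ => μ with hP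
  set Q := Measure.infinitePi fun _ : ℕ => μ[|O] with hQ
  set A : Set (ℕ → X) := (Finset.range k : Set ℕ).pi fun _ => O with hA
  have mA : MeasurableSet A := .pi (Finset.range k).countable_toSet fun _ _ => hO
  have hPA : P A ≠ 0 := by
    rw [hP, hA, Measure.infinitePi_pi _ fun _ _ => hO]
    simp [h0]
  have := cond_isProbabilityMeasure hPA
  have hAc : P Aᶜ ≤ k * μ Oᶜ := by
    have : Aᶜ ⊆ ⋃ i ∈ Finset.range k, (fun x : ℕ → X => x i) ⁻¹' Oᶜ := by
      intro x hx
      simpa [hA, Set.mem_pi] using hx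
    refine (measure_mono this).trans ((measure_biUnion_finset_le _ _).trans ?_)
    have h1 : ∀ i ∈ Finset.range k, P ((fun x : ℕ → X => x i) ⁻¹' Oᶜ) = μ Oᶜ := fun i _ =>
      (measurePreserving_eval_infinitePi (fun _ : ℕ => μ) i).measure_preimage
        hO.compl.nullMeasurableSet
    rw [Finset.sum_congr rfl h1]
    simp
  have hle : P.restrict A ≤ P[|A] := by
    rw [ProbabilityTheory.cond]
    refine Measure.le_iff.2 fun s _ => ?_
    rw [Measure.smul_apply, smul_eq_mul]
    exact le_mul_of_one_le_left zero_le (ENNReal.one_le_inv.2 prob_le_one)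
  have h1 : σ.prod P (F ∩ univ ×ˢ A) ≤ σ.prod (P[|A]) F := by
    have h : (σ.prod P).restrict (univ ×ˢ A) = σ.prod (P.restrict A) := by
      rw [← Measure.prod_restrict, Measure.restrict_univ]
    rw [← Measure.restrict_apply' (MeasurableSet.univ.prod mA), h]
    exact Measure.prod_mono le_rfl hle F
  have h2 : σ.prod (P[|A]) F ≤ σ.prod Q F := by
    -- Resampling from index `k` on does not affect `F`, and turns the conditioned law into `Q`. As
    -- `F` may be non-measurable, only the inequality `Measure.le_map_apply` is available, in the
    -- direction needed.
    set Ψ : (Ω × (ℕ → X)) × (ℕ → X) → Ω × (ℕ → X) := fun q => (q.1.1, splice k q.1.2 q.2)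
    have mΨ : Measurable Ψ :=
      measurable_fst.fst.prodMk
        ((measurable_splice k).comp (measurable_fst.snd.prodMk measurable_snd))
    have hmap : ((σ.prod (P[|A])).prod Q).map Ψ = σ.prod Q := by
      have : Ψ = Prod.map id (fun p : (ℕ → X) × (ℕ → X) => splice k p.1 p.2) ∘
          MeasurableEquiv.prodAssoc := rfl
      rw [this, ← Measure.map_map (measurable_id.prodMap (measurable_splice k))
        MeasurableEquiv.prodAssoc.measurable, Measure.prodAssoc_prod,
        ← Measure.map_prod_map _ _ measurable_id (measurable_splice k), Measure.map_id,
        map_splice_cond μ hO h0 k]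
    calc σ.prod (P[|A]) F = (σ.prod (P[|A])).prod Q (F ×ˢ univ) := by simp [Measure.prod_prod]
      _ ≤ (σ.prod (P[|A])).prod Q (Ψ ⁻¹' F) := by
        refine measure_mono fun q hq => hF q.1.1 q.1.2 _ (fun i hi => ?_) hq.1
        simp [splice, hi]
      _ ≤ σ.prod Q F := hmap ▸ Measure.le_map_apply mΨ.aemeasurable F
  have hsub : F ⊆ (F ∩ univ ×ˢ A) ∪ univ ×ˢ Aᶜ := by
    intro p hp
    by_cases h : p.2 ∈ A
    · exact .inl ⟨hp, trivial, h⟩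
    · exact .inr ⟨trivial, h⟩
  refine (measure_mono hsub).trans ((measure_union_le _ _).trans (add_le_add (h1.trans h2) ?_))
  rw [Measure.prod_prod, measure_univ, one_mul]
  exact hAc

end Coupling

/-! ### From caps to non-learnability -/

section Learning

variable {X : Type v}

theorem LearningAlgorithm.Outputs.unique {A : LearningAlgorithm.{u, v} X} {ε δ : ℝ} {s : A.Seed}
    {x : ℕ → X} {h h' : Hypothesis X} (H : A.Outputs ε δ s x h) (H' : A.Outputs ε δ s x h') :
    h = h' := by
  obtain ⟨k, hk, hlt⟩ := H
  obtain ⟨k', hk', hlt'⟩ := H'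
  rcases lt_trichotomy k k' with hkk | rfl | hkk
  · simp [hlt' k hkk] at hk
  · exact Option.some.inj (hk.symm.trans hk')
  · simp [hlt k' hkk] at hk'

/-- The algorithm terminates with output `h` after at most `k` calls of the oracle. -/
def LearningAlgorithm.OutputsBy (A : LearningAlgorithm.{u, v} X) (ε δ : ℝ) (k : ℕ) (s : A.Seed)
    (x : ℕ → X) (h : Hypothesis X) : Prop :=
  ∃ m ≤ k, A.step ε δ s m (fun i => x i) = some h ∧
    ∀ j < m, A.step ε δ s j (fun i => x i) = none

theorem LearningAlgorithm.OutputsBy.outputs {A : LearningAlgorithm.{u, v} X} {ε δ : ℝ} {k : ℕ}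
    {s : A.Seed} {x : ℕ → X} {h : Hypothesis X} (H : A.OutputsBy ε δ k s x h) :
    A.Outputs ε δ s x h :=
  let ⟨m, _, hm⟩ := H
  ⟨m, hm⟩

theorem LearningAlgorithm.OutputsBy.congr {A : LearningAlgorithm.{u, v} X} {ε δ : ℝ} {k : ℕ}
    {s : A.Seed} {x y : ℕ → X} {h : Hypothesis X} (H : A.OutputsBy ε δ k s x h)
    (hxy : ∀ i < k, x i = y i) : A.OutputsBy ε δ k s y h := by
  obtain ⟨m, hm, hh, hn⟩ := H
  have e : ∀ j ≤ m, (fun i : Fin j => x i) = fun i : Fin j => y i := fun j hj =>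
    funext fun i => hxy i (by omega)
  exact ⟨m, hm, e m le_rfl ▸ hh, fun j hj => e j hj.le ▸ hn j hj⟩

variable [MeasurableSpace X]

/-- An algorithm that terminates almost surely terminates, with outer probability arbitrarily close
to one, within a bounded number of calls. -/
theorem LearningAlgorithm.exists_lt_measure_outputsBy (A : LearningAlgorithm.{u, v} X) {ε δ : ℝ}
    {D : Domain X} (hD : ∀ᵐ ω ∂A.runLaw D, ∃ h, A.Outputs ε δ ω.1 ω.2 h) {c : ℝ≥0∞} (hc : c < 1) :
    ∃ k, c < A.runLaw D {ω | ∃ h, A.OutputsBy ε δ k ω.1 ω.2 h} := by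
  have : IsProbabilityMeasure (A.runLaw D) := by unfold LearningAlgorithm.runLaw; infer_instance
  have hmono : Monotone fun k => {ω : A.Seed × (ℕ → X) | ∃ h, A.OutputsBy ε δ k ω.1 ω.2 h} := by
    rintro k k' hkk ω ⟨h, m, hm, hh⟩
    exact ⟨h, m, hm.trans hkk, hh⟩
  have hU : A.runLaw D (⋃ k, {ω | ∃ h, A.OutputsBy ε δ k ω.1 ω.2 h}) = 1 := by
    rw [← measure_univ (μ := A.runLaw D)]
    refine measure_congr ?_
    rw [Filter.eventuallyEq_univ]
    filter_upwards [hD] with ω hω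
    obtain ⟨h, k, hk⟩ := hω
    exact mem_iUnion.2 ⟨k, h, k, le_rfl, hk⟩
  -- Continuity from below holds for monotone unions of arbitrary sets, so measurability plays no
  -- role.
  rw [hmono.measure_iUnion] at hU
  rw [← hU] at hc
  exact lt_iSup_iff.1 hc

/-- The ID support is itself a hypothesis of risk zero, so the learner competes with zero. -/
theorem DSA.iInf_risk [TopologicalSpace X] [HereditarilyLindelofSpace X] {D : Domain X}
    (hD : DSA D) (α : ℝ) : ⨅ h ∈ (univ : Set (Hypothesis X)), risk α D h = 0 := by
  have hr : risk α D (D.inDist : Measure X).support = 0 := by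
    have hout : (D.outDist : Measure X) (D.inDist : Measure X).support = 0 :=
      measure_mono_null (subset_compl_iff_disjoint_right.2 hD) Measure.measure_compl_support
    rw [risk_eq, hout, Measure.measure_compl_support]
    simp
  exact le_antisymm ((iInf₂_le _ (mem_univ _)).trans hr.le) zero_le

/-- If the risk is at most `α (1 - α) c`, then both components of the risk are at most `c`. -/
theorem le_of_risk_le {α : ℝ} (hα : α ∈ Ioo (0 : ℝ) 1) {c : ℝ} {D : Domain X}
    {h : Hypothesis X} (hr : risk α D h ≤ ENNReal.ofReal (α * (1 - α) * c)) :
    (D.inDist : Measure X) hᶜ ≤ ENNReal.ofReal c ∧ (D.outDist : Measure X) h ≤ ENNReal.ofReal c := by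
  have h1 : (0 : ℝ) < 1 - α := sub_pos.2 hα.2
  rw [risk_eq, ENNReal.ofReal_mul (mul_nonneg hα.1.le h1.le), ENNReal.ofReal_mul hα.1.le] at hr
  have ha : ENNReal.ofReal α ≤ 1 := ENNReal.ofReal_le_one.2 hα.2.le
  have hb : ENNReal.ofReal (1 - α) ≤ 1 := ENNReal.ofReal_le_one.2 (by linarith [hα.1])
  constructor
  · refine (ENNReal.mul_le_mul_iff_right (ENNReal.ofReal_pos.2 h1).ne' ENNReal.ofReal_ne_top).1
      ((le_self_add.trans hr).trans ?_)
    rw [mul_assoc]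
    exact mul_le_of_le_one_left zero_le ha
  · refine (ENNReal.mul_le_mul_iff_right (ENNReal.ofReal_pos.2 hα.1).ne' ENNReal.ofReal_ne_top).1
      ((le_add_self.trans hr).trans ?_)
    rw [mul_assoc]
    gcongr
    exact mul_le_of_le_one_left zero_le hb

/-- Suppose that for every `M` there are `M` events of total `μ`-measure at most one such that
conditioning `μ` on the complement of any of them gives the ID distribution of a domain in `𝒟`, for
an OOD distribution such that the average of the `M` OOD distributions is dominated by `4 μ`.
Then OOD detection is not non-uniformly learnable for `𝒟`. -/
theorem not_nonUniformlyLearnable_of_caps [TopologicalSpace X] [HereditarilyLindelofSpace X]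
    {𝒟 : Set (Domain X)} (hDSA : ∀ D ∈ 𝒟, DSA D) {α : ℝ} (hα : α ∈ Ioo (0 : ℝ) 1)
    {D₀ : Domain X} (hD₀ : D₀ ∈ 𝒟)
    (hcaps : ∀ M : ℕ, 0 < M → ∃ (D : Fin M → Domain X) (O : Fin M → Set X),
      (∀ j, D j ∈ 𝒟) ∧ (∀ j, MeasurableSet (O j)) ∧ (∀ j, (D₀.inDist : Measure X) (O j) ≠ 0) ∧
      (∀ j, ((D j).inDist : Measure X) = (D₀.inDist : Measure X)[|O j]) ∧
      ∑ j, (D₀.inDist : Measure X) (O j)ᶜ ≤ 1 ∧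
      ∀ J : Finset (Fin M),
        ∑ j ∈ J, ((D j).outDist : Measure X) ≤ (4 * M : ℝ≥0∞) • (D₀.inDist : Measure X)) :
    ¬ NonUniformlyLearnable.{u, v} 𝒟 univ α := by
  rintro ⟨A, hA⟩
  set μ : Measure X := (D₀.inDist : Measure X) with hμ
  -- With this `ε`, `le_of_risk_le` bounds each error component by 1/32.
  set ε : ℝ := α * (1 - α) * (1 / 32) with hε
  have h1 : (0 : ℝ) < 1 - α := sub_pos.2 hα.2
  have hεI : ε ∈ Ioo (0 : ℝ) (1 / 2) := by
    refine ⟨by have := hα.1; positivity, ?_⟩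
    nlinarith [hα.1]
  have hδI : (1 / 8 : ℝ) ∈ Ioo (0 : ℝ) (1 / 2) := by norm_num
  have hA := hA ε hεI (1 / 8) hδI
  have hout : ∀ D ∈ 𝒟, A.runLaw D {ω | ¬ ∃ h, A.Outputs ε (1 / 8) ω.1 ω.2 h ∧
      risk α D h ≤ ENNReal.ofReal ε} ≤ ENNReal.ofReal (1 / 8) := by
    intro D hD
    have := (hA D hD).2
    rw [(hDSA D hD).iInf_risk, zero_add] at this
    simpa using this
  have hterm : ∀ᵐ ω ∂A.runLaw D₀, ∃ h, A.Outputs ε (1 / 8) ω.1 ω.2 h := by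
    filter_upwards [(hA D₀ hD₀).1] with ω hω
    obtain ⟨h, -, hh⟩ := hω
    exact ⟨h, hh⟩
  have hhalf : ENNReal.ofReal (1 / 2) < 1 := by
    rw [← ENNReal.ofReal_one]; exact (ENNReal.ofReal_lt_ofReal_iff one_pos).2 (by norm_num)
  obtain ⟨k, hk⟩ := A.exists_lt_measure_outputsBy hterm hhalf
  -- `k ≤ M / 16` keeps the Markov bound for `W` below 3/8; the `+ 1` covers `k = 0`.
  set M : ℕ := 16 * k + 1 with hM
  obtain ⟨D, O, hD𝒟, hOm, hO0, hDin, hOsum, hDout⟩ := hcaps M (by omega)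
  set P := A.runLaw D₀ with hP
  have : IsProbabilityMeasure P := by
    rw [hP]; unfold LearningAlgorithm.runLaw; infer_instance
  set F : Fin M → Set (A.Seed × (ℕ → X)) := fun j =>
    {ω | ∃ h, A.OutputsBy ε (1 / 8) k ω.1 ω.2 h ∧ ¬ risk α (D j) h ≤ ENNReal.ofReal ε} with hF
  have hPF : ∀ j, P (F j) ≤ ENNReal.ofReal (1 / 8) + k * μ (O j)ᶜ := by
    intro j
    refine (prod_infinitePi_le_cond (A.seedLaw : Measure A.Seed) μ (hOm j) (hO0 j) k
      (F := F j) ?_).trans (add_le_add_left ?_ _)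
    · rintro s x y hxy ⟨h, hh, hr⟩
      exact ⟨h, hh.congr hxy, hr⟩
    · rw [← hDin j]
      refine (measure_mono ?_).trans (hout (D j) (hD𝒟 j))
      rintro ω ⟨h, hh, hr⟩ ⟨h', hh', hr'⟩
      exact hr (hh.outputs.unique hh' ▸ hr')
  -- Measurable hulls make the count `N` of bad indices integrable termwise at no cost in measure.
  set B : Fin M → Set (A.Seed × (ℕ → X)) := fun j => toMeasurable P (F j) with hB
  set N : A.Seed × (ℕ → X) → ℝ≥0∞ := fun ω => ∑ j, (B j).indicator 1 ω with hN
  have mN : Measurable N := Finset.measurable_sum _ fun j _ =>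
    measurable_one.indicator (measurableSet_toMeasurable _ _)
  have hNint : ∫⁻ ω, N ω ∂P ≤ M * ENNReal.ofReal (1 / 8) + k := by
    rw [lintegral_finsetSum _ fun j _ =>
      measurable_one.indicator (measurableSet_toMeasurable _ _)]
    calc ∑ j, ∫⁻ ω, (B j).indicator 1 ω ∂P = ∑ j, P (F j) := by
          refine Finset.sum_congr rfl fun j _ => ?_
          rw [lintegral_indicator_one (measurableSet_toMeasurable _ _), measure_toMeasurable]
      _ ≤ ∑ j, (ENNReal.ofReal (1 / 8) + k * μ (O j)ᶜ) := Finset.sum_le_sum fun j _ => hPF j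
      _ = M * ENNReal.ofReal (1 / 8) + k * ∑ j, μ (O j)ᶜ := by
          rw [Finset.sum_add_distrib, Finset.mul_sum]; simp
      _ ≤ M * ENNReal.ofReal (1 / 8) + k := by
          gcongr; exact mul_le_of_le_one_right zero_le hOsum
  set W : Set (A.Seed × (ℕ → X)) := {ω | (M : ℝ≥0∞) * ENNReal.ofReal (1 / 2) ≤ N ω} with hW
  have hPW : P W ≤ ENNReal.ofReal (3 / 8) := by
    have hmarkov := (mul_meas_ge_le_lintegral (μ := P) mN
      ((M : ℝ≥0∞) * ENNReal.ofReal (1 / 2))).trans hNint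
    have hM0 : (M : ℝ≥0∞) * ENNReal.ofReal (1 / 2) ≠ 0 :=
      mul_ne_zero (by simp [hM]) (by norm_num)
    refine (ENNReal.mul_le_mul_iff_right hM0
      (ENNReal.mul_ne_top (ENNReal.natCast_ne_top _) ENNReal.ofReal_ne_top)).1 (hmarkov.trans ?_)
    rw [← ENNReal.ofReal_natCast M, ← ENNReal.ofReal_natCast k,
      ← ENNReal.ofReal_mul (by positivity), ← ENNReal.ofReal_mul (by positivity),
      ← ENNReal.ofReal_mul (by positivity), ← ENNReal.ofReal_add (by positivity) (by positivity)]
    refine ENNReal.ofReal_le_ofReal ?_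
    rw [hM]; push_cast; linarith
  -- Failure on `D₀` and `W` have outer measure at most 1/8 + 3/8 = 1/2, less than that of halting
  -- within `k` calls.
  obtain ⟨ω, ⟨h, hh⟩, hω0, hωW⟩ : ∃ ω : A.Seed × (ℕ → X),
      (∃ h, A.OutputsBy ε (1 / 8) k ω.1 ω.2 h) ∧
      (∃ h, A.Outputs ε (1 / 8) ω.1 ω.2 h ∧ risk α D₀ h ≤ ENNReal.ofReal ε) ∧ ω ∉ W := by
    by_contra! hcon
    refine absurd hk (not_lt.2 ?_)
    have hsub : {ω : A.Seed × (ℕ → X) | ∃ h, A.OutputsBy ε (1 / 8) k ω.1 ω.2 h} ⊆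
        {ω | ¬ ∃ h, A.Outputs ε (1 / 8) ω.1 ω.2 h ∧ risk α D₀ h ≤ ENNReal.ofReal ε} ∪ W := by
      intro ω hω
      by_cases hg : ∃ h, A.Outputs ε (1 / 8) ω.1 ω.2 h ∧ risk α D₀ h ≤ ENNReal.ofReal ε
      · exact .inr (hcon ω hω hg)
      · exact .inl hg
    refine (measure_mono hsub).trans ((measure_union_le _ _).trans
      ((add_le_add (hout D₀ hD₀) hPW).trans ?_))
    rw [← ENNReal.ofReal_add (by norm_num) (by norm_num)]
    exact ENNReal.ofReal_le_ofReal (by norm_num)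
  have hμh : μ hᶜ ≤ ENNReal.ofReal (1 / 32) := by
    obtain ⟨h', hh', hr⟩ := hω0
    rw [← hh.outputs.unique hh'] at hr
    exact (le_of_risk_le hα hr).1
  classical
  set J : Finset (Fin M) := Finset.univ.filter fun j => ω ∉ B j with hJ
  have hgood : ∀ j ∈ J, ENNReal.ofReal (1 / 2) ≤ ((D j).outDist : Measure X) hᶜ := by
    intro j hj
    have hjB : ω ∉ F j := fun hf => (Finset.mem_filter.1 hj).2 (subset_toMeasurable _ _ hf)
    have hr : risk α (D j) h ≤ ENNReal.ofReal ε := by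
      by_contra hcon
      exact hjB ⟨h, hh, hcon⟩
    have hle := (le_of_risk_le hα hr).2
    by_contra! hcon
    have h2 : (1 : ℝ≥0∞) ≤ ((D j).outDist : Measure X) h + ((D j).outDist : Measure X) hᶜ := by
      rw [← measure_univ (μ := ((D j).outDist : Measure X)), ← union_compl_self h]
      exact measure_union_le _ _
    refine absurd (h2.trans (add_le_add hle hcon.le)) (not_le.2 ?_)
    rw [← ENNReal.ofReal_add (by norm_num) (by norm_num), ← ENNReal.ofReal_one]
    exact (ENNReal.ofReal_lt_ofReal_iff one_pos).2 (by norm_num)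
  -- This forces `J.card ≤ M / 4`, whereas `ω ∉ W` gives `J.card > M / 2`.
  have hsum : (J.card : ℝ≥0∞) * ENNReal.ofReal (1 / 2) ≤ 4 * M * ENNReal.ofReal (1 / 32) := by
    calc (J.card : ℝ≥0∞) * ENNReal.ofReal (1 / 2) = ∑ _j ∈ J, ENNReal.ofReal (1 / 2) := by simp
      _ ≤ ∑ j ∈ J, ((D j).outDist : Measure X) hᶜ := Finset.sum_le_sum hgood
      _ = (∑ j ∈ J, ((D j).outDist : Measure X)) hᶜ := by rw [Measure.finsetSum_apply]
      _ ≤ 4 * M * μ hᶜ := hDout J hᶜ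
      _ ≤ 4 * M * ENNReal.ofReal (1 / 32) := by gcongr
  have hNω : N ω = ((Finset.univ.filter fun j => ω ∈ B j).card : ℝ≥0∞) := by
    simp only [hN, indicator_apply, Pi.one_apply]
    rw [Finset.sum_boole]
  have hNlt : N ω < (M : ℝ≥0∞) * ENNReal.ofReal (1 / 2) := not_le.1 hωW
  have hcard := Finset.card_filter_add_card_filter_not (s := (Finset.univ : Finset (Fin M)))
    (fun j => ω ∈ B j)
  rw [Finset.card_univ, Fintype.card_fin] at hcard
  rw [hNω, ← ENNReal.ofReal_natCast, ← ENNReal.ofReal_natCast,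
    ← ENNReal.ofReal_mul (by positivity), ENNReal.ofReal_lt_ofReal_iff (by positivity)] at hNlt
  rw [← ENNReal.ofReal_natCast, ← ENNReal.ofReal_natCast, ← ENNReal.ofReal_ofNat,
    ← ENNReal.ofReal_mul (by positivity), ← ENNReal.ofReal_mul (by positivity),
    ← ENNReal.ofReal_mul (by positivity), ENNReal.ofReal_le_ofReal_iff (by positivity)] at hsum
  have hcard' : ((Finset.univ.filter fun j => ω ∈ B j).card : ℝ) + (J.card : ℝ) = M := by
    exact_mod_cast hcard
  have hMpos : (0 : ℝ) < M := by rw [hM]; positivity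
  linarith

end Learning

/-! ### Supports of measures -/

section Support

variable {X : Type*} [TopologicalSpace X] [MeasurableSpace X]

/-- Every nonempty closed set is the support of some probability measure. -/
theorem exists_isProbabilityMeasure_support_eq [SecondCountableTopology X] [OpensMeasurableSpace X]
    {S : Set X} (hS : IsClosed S) (hne : S.Nonempty) :
    ∃ ρ : Measure X, IsProbabilityMeasure ρ ∧ ρ.support = S := by
  have : Nonempty S := hne.to_subtype
  set d : ℕ → X := fun i => (TopologicalSpace.denseSeq S i : X) with hd
  have md : Measurable d := measurable_from_nat
  -- Any law charging every natural number would do.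
  refine ⟨(poissonMeasure 1).map d, Measure.isProbabilityMeasure_map md.aemeasurable, ?_⟩
  refine Subset.antisymm (Measure.support_subset_of_isClosed hS ?_) fun x hx => ?_
  · rw [mem_ae_iff, Measure.map_apply md hS.isOpen_compl.measurableSet]
    convert measure_empty (μ := poissonMeasure 1)
    ext i
    simp [hd]
  · rw [Measure.support_eq_forall_isOpen]
    intro U hxU hU
    obtain ⟨i, hi⟩ := (TopologicalSpace.denseRange_denseSeq S).exists_mem_open
      (hU.preimage continuous_subtype_val) ⟨⟨x, hx⟩, hxU⟩
    rw [Measure.map_apply md hU.measurableSet]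
    refine lt_of_lt_of_le ?_ (measure_mono (singleton_subset_iff.2 hi))
    rw [poissonMeasure_singleton]
    exact ENNReal.ofReal_pos.2 (by positivity)

/-- The support of the restriction of a measure to an open set. -/
theorem support_restrict_of_isOpen [HereditarilyLindelofSpace X] [OpensMeasurableSpace X]
    (μ : Measure X) {O : Set X} (hO : IsOpen O) :
    (μ.restrict O).support = closure (O ∩ μ.support) := by
  refine Subset.antisymm ?_ (closure_minimal ?_ Measure.isClosed_support)
  · refine Measure.support_subset_of_isClosed isClosed_closure ?_
    rw [mem_ae_iff, Measure.restrict_apply isClosed_closure.isOpen_compl.measurableSet]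
    refine measure_mono_null (fun x hx hxs => hx.1 (subset_closure ⟨hx.2, hxs⟩))
      (Measure.measure_compl_support (μ := μ))
  · simpa [hO.interior_eq] using Measure.interior_inter_support (μ := μ) (s := O)

theorem support_cond_of_isOpen [HereditarilyLindelofSpace X] [OpensMeasurableSpace X]
    (μ : Measure X) [IsFiniteMeasure μ] {O : Set X} (hO : IsOpen O) :
    (μ[|O]).support = closure (O ∩ μ.support) := by
  rw [← support_restrict_of_isOpen μ hO]
  rw [ProbabilityTheory.cond]
  refine Subset.antisymm Measure.smul_absolutelyContinuous.support_mono
    (Measure.AbsolutelyContinuous.support_mono ?_)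
  exact Measure.AbsolutelyContinuous.rfl.smul_right (ENNReal.inv_ne_zero.2 (measure_ne_top _ _))

end Support

/-! ### Caps of a parabola -/

section Parabola

variable {n : ℕ}

local notation "E" => EuclideanSpace ℝ (Fin n)

/-- The parabola `x_b = x_a ^ 2` in the plane of the coordinates `a` and `b`. -/
noncomputable def parabola (a b : Fin n) (s : ℝ) : E :=
  WithLp.toLp 2 fun i => if i = a then s else if i = b then s ^ 2 else 0

theorem parabola_apply_left (a b : Fin n) (s : ℝ) : parabola a b s a = s := by
  simp [parabola]

theorem parabola_apply_right {a b : Fin n} (hab : a ≠ b) (s : ℝ) : parabola a b s b = s ^ 2 := by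
  simp [parabola, hab.symm]

theorem measurable_parabola (a b : Fin n) : Measurable (parabola a b) := by
  refine (WithLp.measurable_toLp 2 _).comp (measurable_pi_lambda _ fun i => ?_)
  split_ifs <;> fun_prop

/-- The epigraph `x_a ^ 2 ≤ x_b`. -/
def parabolaEpigraph (a b : Fin n) : Set E := {x | x a ^ 2 ≤ x b}

theorem isClosed_parabolaEpigraph (a b : Fin n) : IsClosed (parabolaEpigraph a b) :=
  isClosed_le (by fun_prop) (by fun_prop)

theorem convex_parabolaEpigraph (a b : Fin n) : Convex ℝ (parabolaEpigraph a b) := by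
  intro x hx y hy c d hc hd hcd
  simp only [parabolaEpigraph, mem_ofPred_eq, PiLp.add_apply, PiLp.smul_apply, smul_eq_mul] at *
  have h1 := mul_le_mul_of_nonneg_left hx hc
  have h2 := mul_le_mul_of_nonneg_left hy hd
  obtain rfl : d = 1 - c := by linarith
  -- For `c + d = 1`, `c u² + d v² - (c u + d v)² = c d (u - v)²`.
  nlinarith [mul_nonneg (mul_nonneg hc hd) (sq_nonneg (x a - y a))]

theorem parabola_mem_parabolaEpigraph {a b : Fin n} (hab : a ≠ b) (s : ℝ) :
    parabola a b s ∈ parabolaEpigraph a b := by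
  simp [parabolaEpigraph, parabola_apply_left, parabola_apply_right hab]

/-- The open half-space whose complement cuts off from the epigraph the part at which the slope-`2t`
tangent line of the parabola is at most `r ^ 2` away in the vertical direction. -/
def capComplement (a b : Fin n) (t r : ℝ) : Set E := {x | 2 * t * x a - x b < t ^ 2 - r ^ 2}

theorem isOpen_capComplement (a b : Fin n) (t r : ℝ) : IsOpen (capComplement a b t r) :=
  isOpen_lt (by fun_prop) (by fun_prop)

theorem convex_capComplement (a b : Fin n) (t r : ℝ) : Convex ℝ (capComplement a b t r) := by
  intro x hx y hy c d hc hd hcd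
  simp only [capComplement, mem_ofPred_eq, PiLp.add_apply, PiLp.smul_apply, smul_eq_mul] at *
  obtain rfl : d = 1 - c := by linarith
  rcases hc.eq_or_lt with rfl | hc
  · linarith
  · have h1 := mul_lt_mul_of_pos_left hx hc
    have h2 := mul_le_mul_of_nonneg_left hy.le hd
    nlinarith

/-- Adding the two defining inequalities gives `(x a - t)² ≤ r²`. Caps with well-separated `t` are
therefore disjoint. -/
theorem abs_le_of_notMem_capComplement {a b : Fin n} {t r : ℝ} (hr : 0 ≤ r) {x : E}
    (hx : x ∈ parabolaEpigraph a b) (hxO : x ∉ capComplement a b t r) : |x a - t| ≤ r := by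
  simp only [capComplement, parabolaEpigraph, mem_ofPred_eq, not_lt] at *
  refine abs_le_of_sq_le_sq ?_ hr
  nlinarith

/-- There is a distribution whose support is the epigraph and which dominates half of the law of
`parabola a b s` for uniformly distributed `s ∈ [0, 1]`. -/
theorem exists_parabola_measure {a b : Fin n} (hab : a ≠ b) : ∃ μ : Measure E,
    IsProbabilityMeasure μ ∧ μ.support = parabolaEpigraph a b ∧
      (volume.restrict (Icc (0 : ℝ) 1)).map (parabola a b) ≤ (2 : ℝ≥0∞) • μ := by
  obtain ⟨ρ, hρ, hρs⟩ := exists_isProbabilityMeasure_support_eq (isClosed_parabolaEpigraph a b)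
    ⟨_, parabola_mem_parabolaEpigraph hab 0⟩
  set ν : Measure E := (volume.restrict (Icc (0 : ℝ) 1)).map (parabola a b) with hν
  have : IsProbabilityMeasure (volume.restrict (Icc (0 : ℝ) 1)) := ⟨by simp⟩
  have : IsProbabilityMeasure ν :=
    Measure.isProbabilityMeasure_map (measurable_parabola a b).aemeasurable
  have h2 : (2 : ℝ≥0∞) * 2⁻¹ = 1 := ENNReal.mul_inv_cancel (by norm_num) (by norm_num)
  have hνs : ν.support ⊆ parabolaEpigraph a b := by
    refine Measure.support_subset_of_isClosed (isClosed_parabolaEpigraph a b) ?_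
    rw [mem_ae_iff, Measure.map_apply (measurable_parabola a b)
      (isClosed_parabolaEpigraph a b).isOpen_compl.measurableSet]
    convert measure_empty (μ := volume.restrict (Icc (0 : ℝ) 1))
    ext s
    simp [parabola_mem_parabolaEpigraph hab]
  have hs : ∀ m : Measure E, ((2 : ℝ≥0∞)⁻¹ • m).support = m.support := by
    intro m
    ext x
    simp [Measure.mem_support_iff]
  refine ⟨(2 : ℝ≥0∞)⁻¹ • ν + (2 : ℝ≥0∞)⁻¹ • ρ, ⟨?_⟩, ?_, ?_⟩
  · simp [ENNReal.inv_two_add_inv_two]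
  · rw [Measure.support_add, hs, hs, hρs, union_eq_right.2 hνs]
  · rw [smul_add, smul_smul, smul_smul, h2, one_smul, one_smul]
    exact Measure.le_add_right le_rfl

/-- On the parabola `2 t s - s² = t² - (s - t)²`, so the OOD arc lies where the linear form is at
least `t² - r'²`, while the ID support lies where it is at most `t² - r²`. The gap `r' < r` keeps
even the closures apart. -/
theorem mem_convexDomainSpace_of_cap {a b : Fin n} (hab : a ≠ b) {μ : Measure E}
    [IsProbabilityMeasure μ] (hμ : μ.support = parabolaEpigraph a b) {t r r' : ℝ} (hr' : 0 ≤ r')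
    (hr : r' < r) {D : Domain E} (hin : (D.inDist : Measure E) = μ[|capComplement a b t r])
    (hout : (D.outDist : Measure E) =
      (volume[|Icc (t - r') (t + r')]).map (parabola a b)) : D ∈ convexDomainSpace n := by
  have hsupp : (D.inDist : Measure E).support =
      closure (capComplement a b t r ∩ parabolaEpigraph a b) := by
    rw [hin, support_cond_of_isOpen μ (isOpen_capComplement a b t r), hμ]
  constructor
  · have h1 : (D.inDist : Measure E).support ⊆ {x | 2 * t * x a - x b ≤ t ^ 2 - r ^ 2} := by
      rw [hsupp]
      refine closure_minimal (fun x hx => ?_) (isClosed_le (by fun_prop) (by fun_prop))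
      exact le_of_lt (show 2 * t * x a - x b < t ^ 2 - r ^ 2 from hx.1)
    have hcl : IsClosed {x : E | t ^ 2 - r' ^ 2 ≤ 2 * t * x a - x b} :=
      isClosed_le (by fun_prop) (by fun_prop)
    have h2 : (D.outDist : Measure E).support ⊆ {x | t ^ 2 - r' ^ 2 ≤ 2 * t * x a - x b} := by
      refine Measure.support_subset_of_isClosed hcl ?_
      rw [hout, mem_ae_iff, Measure.map_apply (measurable_parabola a b)
        hcl.isOpen_compl.measurableSet, cond_apply measurableSet_Icc]
      convert mul_zero _
      convert measure_empty (μ := (volume : Measure ℝ))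
      ext s
      simp only [mem_inter_iff, mem_Icc, mem_preimage, mem_compl_iff, mem_ofPred_eq, not_le,
        parabola_apply_left, parabola_apply_right hab, mem_empty_iff_false, iff_false, not_and,
        not_lt]
      rintro ⟨hs1, hs2⟩
      nlinarith
    refine disjoint_left.2 fun x hx hx' => ?_
    have h3 := h1 hx
    have h4 := h2 hx'
    simp only [mem_ofPred_eq] at h3 h4
    nlinarith
  · rw [ConvexID, hsupp]
    exact ((convex_capComplement a b t r).inter (convex_parabolaEpigraph a b)).closure

theorem measure_capComplement_ne_zero {a b : Fin n} (hab : a ≠ b) {μ : Measure E}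
    (hμ : μ.support = parabolaEpigraph a b) (t r : ℝ) : μ (capComplement a b t r) ≠ 0 := by
  -- A point of the parabola beyond the cap: its parameter is more than `|r|` away from `t`.
  have hmem : parabola a b (t + |r| + 1) ∈ μ.support :=
    hμ ▸ parabola_mem_parabolaEpigraph hab _
  rw [Measure.support_eq_forall_isOpen] at hmem
  refine (hmem _ ?_ (isOpen_capComplement a b t r)).ne'
  simp only [capComplement, mem_ofPred_eq, parabola_apply_left, parabola_apply_right hab]
  nlinarith [abs_nonneg r, sq_abs r]

theorem exists_parabola_caps {a b : Fin n} (hab : a ≠ b) {μ : Measure E} [IsProbabilityMeasure μ]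
    (hμ : μ.support = parabolaEpigraph a b)
    (hle : (volume.restrict (Icc (0 : ℝ) 1)).map (parabola a b) ≤ (2 : ℝ≥0∞) • μ)
    {M : ℕ} (hM : 0 < M) : ∃ (D : Fin M → Domain E) (O : Fin M → Set E),
      (∀ j, D j ∈ convexDomainSpace n) ∧ (∀ j, MeasurableSet (O j)) ∧ (∀ j, μ (O j) ≠ 0) ∧
      (∀ j, ((D j).inDist : Measure E) = μ[|O j]) ∧ ∑ j, μ (O j)ᶜ ≤ 1 ∧
      ∀ J : Finset (Fin M), ∑ j ∈ J, ((D j).outDist : Measure E) ≤ (4 * M : ℝ≥0∞) • μ := by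
  have hM' : (0 : ℝ) < M := Nat.cast_pos.2 hM
  -- Midpoints of the `M` equal subintervals of `[0, 1]`. Since `2 r < 1 / M` the caps are disjoint,
  -- and `r' < r` leaves arcs of parameter length `1 / (2 M)`.
  set t : Fin M → ℝ := fun j => ((j : ℝ) + 1 / 2) / M with ht
  set r : ℝ := 1 / (3 * M) with hr
  set r' : ℝ := 1 / (4 * M) with hr'
  have hr'0 : 0 < r' := by positivity
  have hrr : r' < r := one_div_lt_one_div_of_lt (by positivity) (by linarith)
  have hsep : ∀ i j : Fin M, i ≠ j → 2 * r < |t i - t j| := by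
    intro i j hij
    have h1 : (1 : ℝ) ≤ |(i : ℝ) - (j : ℝ)| := by
      have : (1 : ℤ) ≤ |(i : ℤ) - (j : ℤ)| :=
        Int.one_le_abs (sub_ne_zero.2 fun h => hij (Fin.ext (by exact_mod_cast h)))
      exact_mod_cast this
    have h2 : t i - t j = ((i : ℝ) - j) / M := by rw [ht]; ring
    rw [h2, abs_div, abs_of_pos hM', hr, lt_div_iff₀ hM']
    have : 2 * (1 / (3 * (M : ℝ))) * M = 2 / 3 := by field_simp
    linarith
  set O : Fin M → Set E := fun j => capComplement a b (t j) r with hO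
  have hOm : ∀ j, MeasurableSet (O j) := fun j => (isOpen_capComplement a b (t j) r).measurableSet
  have hO0 : ∀ j, μ (O j) ≠ 0 := fun j => measure_capComplement_ne_zero hab hμ _ _
  set I : Fin M → Set ℝ := fun j => Icc (t j - r') (t j + r') with hI
  have hIvol : ∀ j, volume (I j) = (2 * M : ℝ≥0∞)⁻¹ := by
    intro j
    rw [hI, Real.volume_Icc]
    have : t j + r' - (t j - r') = (2 * (M : ℝ))⁻¹ := by rw [hr']; field_simp; ring
    rw [this, ENNReal.ofReal_inv_of_pos (by positivity), ENNReal.ofReal_mul (by norm_num)]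
    simp
  have h2M : (2 * M : ℝ≥0∞) ≠ 0 := by simp [hM.ne']
  have h2M' : (2 * M : ℝ≥0∞) ≠ ∞ := ENNReal.mul_ne_top (by simp) (by simp)
  have hI0 : ∀ j, volume (I j) ≠ 0 := fun j => by rw [hIvol]; exact ENNReal.inv_ne_zero.2 h2M'
  have hItop : ∀ j, volume (I j) ≠ ∞ := fun j => by rw [hIvol]; exact ENNReal.inv_ne_top.2 h2M
  have hin : ∀ j, IsProbabilityMeasure (μ[|O j]) := fun j => cond_isProbabilityMeasure (hO0 j)
  have hcI : ∀ j, IsProbabilityMeasure (volume[|I j]) := fun j =>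
    cond_isProbabilityMeasure_of_finite (hI0 j) (hItop j)
  have hout : ∀ j, IsProbabilityMeasure ((volume[|I j]).map (parabola a b)) := fun j =>
    Measure.isProbabilityMeasure_map (measurable_parabola a b).aemeasurable
  refine ⟨fun j => ⟨⟨μ[|O j], hin j⟩, ⟨(volume[|I j]).map (parabola a b), hout j⟩⟩, O,
    fun j => mem_convexDomainSpace_of_cap hab hμ hr'0.le hrr rfl rfl, hOm, hO0,
    fun j => rfl, ?_, fun J => ?_⟩
  · have hP : ∀ j, μ (O j)ᶜ = μ ((O j)ᶜ ∩ parabolaEpigraph a b) := fun j =>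
      (measure_inter_conull (by rw [← hμ]; exact Measure.measure_compl_support)).symm
    simp_rw [hP]
    rw [← measure_biUnion_finset]
    · exact prob_le_one
    · intro i _ j _ hij
      refine disjoint_left.2 fun x hx hx' => (hsep i j hij).not_ge ?_
      have h1 := abs_le_of_notMem_capComplement (hr'0.trans hrr).le hx.2 hx.1
      have h2 := abs_le_of_notMem_capComplement (hr'0.trans hrr).le hx'.2 hx'.1
      rw [abs_sub_comm] at h1
      linarith [abs_sub_le (t i) (x a) (t j)]
    · exact fun j _ => (hOm j).compl.inter (isClosed_parabolaEpigraph a b).measurableSet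
  · have hIsub : (⋃ j ∈ J, I j) ⊆ Icc 0 1 := by
      refine iUnion₂_subset fun j _ s hs => ?_
      have hj : (j : ℝ) + 1 ≤ M := by exact_mod_cast j.2
      have h1 : t j - r' = ((j : ℝ) + 1 / 4) / M := by rw [hr']; simp only [ht]; field_simp; ring
      have h2 : t j + r' = ((j : ℝ) + 3 / 4) / M := by rw [hr']; simp only [ht]; field_simp; ring
      have h3 : 0 ≤ t j - r' := by rw [h1]; positivity
      have h4 : t j + r' ≤ 1 := by rw [h2, div_le_one hM']; linarith
      exact ⟨h3.trans hs.1, hs.2.trans h4⟩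
    have hdisj : (J : Set (Fin M)).Pairwise (Function.onFun Disjoint I) := by
      intro i _ j _ hij
      refine disjoint_left.2 fun s hs hs' => (hsep i j hij).not_ge ?_
      rw [abs_le]
      constructor <;> linarith [hs.1, hs.2, hs'.1, hs'.2]
    have hsum : ∑ j ∈ J, volume.restrict (I j) ≤ volume.restrict (Icc (0 : ℝ) 1) := by
      refine le_trans (le_of_eq ?_) (Measure.restrict_mono hIsub le_rfl)
      rw [Measure.restrict_biUnion_finset hdisj fun _ => measurableSet_Icc, Measure.sum_fintype,
        Finset.sum_coe_sort J fun j => volume.restrict (I j)]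
    -- Normalizing each arc costs `2 M`, and the half weight of the arc in `μ` costs another 2.
    calc ∑ j ∈ J, (volume[|I j]).map (parabola a b)
        = (2 * M : ℝ≥0∞) • (∑ j ∈ J, volume.restrict (I j)).map (parabola a b) := by
          simp only [ProbabilityTheory.cond, hIvol, inv_inv, Measure.map_smul]
          rw [← Finset.smul_sum, Measure.map_finset_sum (measurable_parabola a b).aemeasurable]
      _ ≤ (2 * M : ℝ≥0∞) • (2 : ℝ≥0∞) • μ :=
          Measure.le_iff'.2 fun s => by
            rw [Measure.smul_apply, Measure.smul_apply (2 * M : ℝ≥0∞), smul_eq_mul, smul_eq_mul]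
            gcongr
            exact (Measure.map_mono hsum (measurable_parabola a b)).trans hle
      _ = (4 * M : ℝ≥0∞) • μ := by rw [smul_smul]; congr 1; ring

end Parabola

end OODDetection

theorem mainTheorem8 (n : ℕ) (hn : 2 ≤ n) (α : ℝ) (hα : α ∈ Set.Ioo (0 : ℝ) 1) :
    ¬ OODDetection.NonUniformlyLearnable.{u, 0} (OODDetection.convexDomainSpace n)
      (Set.univ : Set (OODDetection.Hypothesis (EuclideanSpace ℝ (Fin n)))) α := by
  open OODDetection in
  set a : Fin n := ⟨0, by omega⟩ with ha
  set b : Fin n := ⟨1, by omega⟩ with hb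
  have hab : a ≠ b := by simp [ha, hb]
  obtain ⟨μ, hμ, hsupp, hle⟩ := exists_parabola_measure hab
  -- Any point off the epigraph serves: the OOD law of `D₀` only has to satisfy DSA.
  set z : EuclideanSpace ℝ (Fin n) := EuclideanSpace.single b (-1) with hz
  have hzs : z ∉ parabolaEpigraph a b := by
    simp [hz, parabolaEpigraph, hab]
  refine not_nonUniformlyLearnable_of_caps (fun D hD => hD.1) hα
    (D₀ := ⟨⟨μ, hμ⟩, ⟨Measure.dirac z, inferInstance⟩⟩) ⟨?_, ?_⟩
    fun M hM => exists_parabola_caps hab hsupp hle hM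
  · have h : (Measure.dirac z).support ⊆ {z} :=
      Measure.support_subset_of_isClosed isClosed_singleton (by simp)
    refine disjoint_left.2 fun x hx hx' => ?_
    obtain rfl := h hx'
    exact hzs (hsupp ▸ hx)
  · exact (congrArg (Convex ℝ) hsupp).mpr (convex_parabolaEpigraph a b)
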